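/- Let $\Delta=\{z\in\mathbb C:|z|\le 1\}$ be the closed unit disk, $\Gamma=\{|z|=1\}$ the unit circle, and let $A_0$ be the disk algebra, i.e. the set of all functions that are continuous on $\Delta$ and holomorphic in $\operatorname{int}\Delta=\{|z|<1\}$. Let $\varphi:\Delta\to\mathbb C$ be a continuous function whose restriction to $\Gamma$ is real analytic, and put $$M=\{a+b\varphi : a,b\in A_0\}\subset C(\Delta).$$ Assume that for each $x\in\operatorname{int}\Delta$ there exists a constant $M_x$ such that $$|f(x)|\le M_x\cdot\sup_{\Gamma}|f|\qquad\text{for all } f\in M.$$ Then $\varphi$ is holomorphic in $\operatorname{int}\Delta$, and hence so is every function in $M$; that is, $M\subset A_0$. -/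

import Mathlib

open Set Metric

/-- The disk algebra: functions continuous on the closed unit disk and holomorphic in the open
unit disk. Functions on the closed disk are represented by total functions `ℂ → ℂ`; values
outside the closed disk are irrelevant. -/
def diskAlgebra : Set (ℂ → ℂ) :=
  {f | ContinuousOn f (closedBall (0 : ℂ) 1) ∧ DifferentiableOn ℂ f (ball (0 : ℂ) 1)}

/-- The module `{a + b φ : a, b in the disk algebra}` of functions on the closed unit disk. -/
def diskModule (φ : ℂ → ℂ) : Set (ℂ → ℂ) :=
  {f | ∃ a ∈ diskAlgebra, ∃ b ∈ diskAlgebra,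
    ∀ z ∈ closedBall (0 : ℂ) 1, f z = a z + b z * φ z}

/-- The restriction of `φ` to the unit circle is real analytic, in the angular coordinate. -/
def RealAnalyticOnUnitCircle (φ : ℂ → ℂ) : Prop :=
  ∀ t : ℝ, AnalyticAt ℝ (fun θ : ℝ => φ (Complex.exp (θ * Complex.I))) t

/-- The sup-norm on the unit circle (the supremum is finite for functions continuous there). -/
noncomputable def circleSupNorm (f : ℂ → ℂ) : ℝ :=
  ⨆ z : sphere (0 : ℂ) 1, ‖f z‖

open Filter Topology Complex MeasureTheory

/-! Near 1, φ on the circle extends to a holomorphic Φ. By Hahn–Banach, evaluation at an interior x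
is a functional L on C(Γ). Put k_w(z) = (φ(z) - Φ(w))/(z - w), a holomorphic C(Γ)-valued family for
w near 1. When |w| > 1, 1/(z - w) lies in the disk algebra, so L(k_w) = (φ(x) - Φ(w))/(x - w); the
identity theorem carries this to |w| < 1. There k_w splits into two Cauchy-kernel terms, giving ΦH =
G with G, H holomorphic in the whole disk, H(x) = 1 and G(x) = φ(x). The quotient G/H does not
depend on x, since it equals Φ near 1. Comparing the pairs of x and y at the point y gives φH = G on
the disk, so φ = G/H near x. -/

/-- A bounded family of scalar holomorphic functions, depending continuously on a parameter in a
compact space, is holomorphic as a map into the space of continuous functions. -/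
theorem ContinuousMap.differentiableOn_ball_of_bounded {X : Type*} [TopologicalSpace X]
    [CompactSpace X] {g : ℂ → C(X, ℂ)} {c : ℂ} {r B : ℝ}
    (hd : ∀ x, DifferentiableOn ℂ (fun w => g w x) (ball c r))
    (hB : ∀ w ∈ ball c r, ∀ x, ‖g w x‖ ≤ B) : DifferentiableOn ℂ g (ball c r) := by
  have hcont : ContinuousOn g (ball c r) := by
    intro w hw
    have hB0 : ∀ x : X, 0 ≤ B := fun x => (norm_nonneg _).trans (hB w hw x)
    obtain ⟨ε, hε, hsub⟩ := Metric.isOpen_iff.1 isOpen_ball w hw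
    refine ContinuousAt.continuousWithinAt ?_
    have hb : ∀ᶠ z in 𝓝 w, dist (g z) (g w) ≤ 2 * |B| / ε * dist z w := by
      filter_upwards [ball_mem_nhds w hε] with z hz
      rw [ContinuousMap.dist_le (by positivity)]
      intro x
      refine Complex.dist_le_div_mul_dist_of_mapsTo_ball (f := fun w => g w x) (R₁ := ε)
        ((hd x).mono hsub) ?_ hz
      intro y hy
      rw [mem_closedBall, dist_eq_norm]
      have h1 := hB y (hsub hy) x
      have h2 := hB w hw x
      have h3 := norm_sub_le (g y x) (g w x)
      have h4 := le_abs_self B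
      linarith
    refine tendsto_iff_dist_tendsto_zero.2 (squeeze_zero' (Eventually.of_forall fun _ => dist_nonneg)
      hb ?_)
    have : Tendsto (fun z => 2 * |B| / ε * dist z w) (𝓝 w) (𝓝 (2 * |B| / ε * dist w w)) :=
      Continuous.tendsto (by fun_prop) w
    simpa using this
  intro w hw
  obtain ⟨R, hwR, hRr⟩ := exists_between (mem_ball.1 hw)
  have hR0 : 0 < R := dist_nonneg.trans_lt hwR
  lift R to NNReal using hR0.le
  have hsub : closedBall c (R : ℝ) ⊆ ball c r := closedBall_subset_ball hRr
  have hint : CircleIntegrable g c R :=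
    ContinuousOn.circleIntegrable hR0.le (hcont.mono (sphere_subset_closedBall.trans hsub))
  have hps := hasFPowerSeriesOn_cauchy_integral hint (by exact_mod_cast hR0)
  have heq : ∀ z ∈ ball c (R : ℝ),
      g z = (2 * Real.pi * I : ℂ)⁻¹ • ∮ u in C(c, R), (u - z)⁻¹ • g u := by
    intro z hz
    ext x
    have h1 := two_pi_I_inv_smul_circleIntegral_sub_inv_smul_of_differentiable_on_off_countable
      (f := fun w => g w x) (s := ∅) countable_empty hz
      ((hd x).continuousOn.mono hsub)
      (fun y hy => (hd x).differentiableAt (isOpen_ball.mem_nhds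
        (hsub (ball_subset_closedBall hy.1))))
    rw [← h1]
    have hci : CircleIntegrable (fun u => (u - z)⁻¹ • g u) c R := by
      refine ContinuousOn.circleIntegrable hR0.le ?_
      refine ContinuousOn.smul ((continuousOn_id.sub continuousOn_const).inv₀ ?_)
        (hcont.mono (sphere_subset_closedBall.trans hsub))
      rintro u hu h0
      rw [show u = z from sub_eq_zero.1 h0] at hu
      exact absurd (mem_sphere.1 hu) (mem_ball.1 hz).ne
    have h2 := (ContinuousMap.evalCLM ℂ x : C(X, ℂ) →L[ℂ] ℂ).intervalIntegral_comp_comm hci.out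
    rw [ContinuousMap.smul_apply]
    exact congrArg _ h2
  have hwR' : w ∈ ball c (R : ℝ) := hwR
  refine DifferentiableAt.differentiableWithinAt ?_
  refine DifferentiableAt.congr_of_eventuallyEq ?_
    (eventually_of_mem (isOpen_ball.mem_nhds hwR') heq)
  have := hps.differentiableOn.differentiableAt (x := w)
    (by rw [eball_coe]; exact isOpen_ball.mem_nhds hwR')
  exact this

/-! ### Holomorphic extension across the circle -/

/-- A real analytic function of one real variable extends holomorphically to a neighbourhood. -/
theorem AnalyticAt.exists_complex_extension {F : ℝ → ℂ} (hF : AnalyticAt ℝ F 0) :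
    ∃ G : ℂ → ℂ, AnalyticAt ℂ G 0 ∧ ∀ᶠ t : ℝ in 𝓝 0, G t = F t := by
  obtain ⟨p, hp⟩ := hF
  obtain ⟨C, r, -, hr, hCr⟩ := p.le_mul_pow_of_radius_pos hp.radius_pos
  lift r to NNReal using hr.le
  -- The same coefficients, read as a complex power series; their norms are unchanged, so the radius
  -- stays positive.
  let q : FormalMultilinearSeries ℂ ℂ ℂ := FormalMultilinearSeries.ofScalars ℂ p.coeff
  have hq : 0 < q.radius := by
    have hle : ((r⁻¹ : NNReal) : ENNReal) ≤ q.radius := by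
      refine q.le_radius_of_bound C fun n => ?_
      change ‖FormalMultilinearSeries.ofScalars ℂ p.coeff n‖ * ((r⁻¹ : NNReal) : ℝ) ^ n ≤ C
      rw [FormalMultilinearSeries.ofScalars_norm, ← FormalMultilinearSeries.norm_apply_eq_norm_coef,
        NNReal.coe_inv, inv_pow, ← div_eq_mul_inv, div_le_iff₀ (by positivity)]
      exact hCr n
    refine lt_of_lt_of_le ?_ hle
    rw [ENNReal.coe_pos]
    exact inv_pos.2 (by exact_mod_cast hr)
  have hqs : HasFPowerSeriesAt q.sum q 0 := (q.hasFPowerSeriesOnBall hq).hasFPowerSeriesAt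
  refine ⟨q.sum, hqs.analyticAt, ?_⟩
  have h1 := hasFPowerSeriesAt_iff.1 hp
  have h2 := hasFPowerSeriesAt_iff.1 hqs
  have h3 : Tendsto (fun t : ℝ => (t : ℂ)) (𝓝 0) (𝓝 0) := by
    simpa using Complex.continuous_ofReal.tendsto 0
  filter_upwards [h1, h3.eventually h2] with t ht1 ht2
  simp only [zero_add] at ht1 ht2
  refine ht2.unique ?_
  convert ht1 using 2 with n
  simp [q, FormalMultilinearSeries.coeff_ofScalars]

/-- A function that is real analytic on the circle extends holomorphically across it near `1`. -/
theorem RealAnalyticOnUnitCircle.exists_extension_near_one {φ : ℂ → ℂ}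
    (h : RealAnalyticOnUnitCircle φ) :
    ∃ Φ : ℂ → ℂ, AnalyticAt ℂ Φ 1 ∧ ∀ᶠ w in 𝓝 (1 : ℂ), w ∈ sphere (0 : ℂ) 1 → Φ w = φ w := by
  obtain ⟨G, hG, hGF⟩ := AnalyticAt.exists_complex_extension (h 0)
  refine ⟨fun w => G (-I * Complex.log w), ?_, ?_⟩
  · have hl : AnalyticAt ℂ (fun w => -I * Complex.log w) 1 :=
      analyticAt_const.mul (analyticAt_clog (by simp))
    exact AnalyticAt.fun_comp (by simpa using hG) hl
  · have harg : Tendsto Complex.arg (𝓝 1) (𝓝 0) := by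
      simpa [ContinuousAt] using Complex.continuousAt_arg (x := 1) (by simp)
    filter_upwards [harg.eventually hGF] with w hw hw1
    have hn : ‖w‖ = 1 := by simpa using hw1
    have hlog : Complex.log w = Complex.arg w * I := by
      simp [Complex.log, hn]
    have hexp : Complex.exp (Complex.arg w * I) = w := by
      simpa [hn] using Complex.norm_mul_exp_arg_mul_I w
    rw [hexp] at hw
    rw [← hw, hlog]
    congr 1
    linear_combination -(Complex.arg w : ℂ) * I_mul_I

/-! ### Evaluation as a functional on C(Γ) -/

theorem diskAlgebra_const (c : ℂ) : (fun _ => c) ∈ diskAlgebra :=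
  ⟨continuousOn_const, differentiableOn_const c⟩

theorem diskAlgebra_add {a b : ℂ → ℂ} (ha : a ∈ diskAlgebra) (hb : b ∈ diskAlgebra) :
    (fun z => a z + b z) ∈ diskAlgebra :=
  ⟨ha.1.add hb.1, ha.2.add hb.2⟩

theorem diskAlgebra_const_mul {a : ℂ → ℂ} (c : ℂ) (ha : a ∈ diskAlgebra) :
    (fun z => c * a z) ∈ diskAlgebra :=
  ⟨continuousOn_const.mul ha.1, ha.2.const_mul c⟩

/-- `diskModule φ` as a complex vector space. -/
def diskSubmodule (φ : ℂ → ℂ) : Submodule ℂ (ℂ → ℂ) where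
  carrier := diskModule φ
  zero_mem' := ⟨_, diskAlgebra_const 0, _, diskAlgebra_const 0, fun z _ => by simp⟩
  add_mem' := by
    rintro f g ⟨a, ha, b, hb, hf⟩ ⟨c, hc, d, hd, hg⟩
    refine ⟨_, diskAlgebra_add ha hc, _, diskAlgebra_add hb hd, fun z hz => ?_⟩
    rw [Pi.add_apply, hf z hz, hg z hz]
    ring
  smul_mem' := by
    rintro k f ⟨a, ha, b, hb, hf⟩
    refine ⟨_, diskAlgebra_const_mul k ha, _, diskAlgebra_const_mul k hb, fun z hz => ?_⟩
    rw [Pi.smul_apply, smul_eq_mul, hf z hz]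
    ring

theorem diskModule_continuousOn {φ f : ℂ → ℂ} (hφ : ContinuousOn φ (closedBall (0 : ℂ) 1))
    (hf : f ∈ diskModule φ) : ContinuousOn f (closedBall (0 : ℂ) 1) := by
  obtain ⟨a, ha, b, hb, hf⟩ := hf
  exact (ha.1.add (hb.1.mul hφ)).congr hf

/-- Restriction of the elements of the module to the unit circle. -/
def diskSubmodule.restrict {φ : ℂ → ℂ} (hφ : ContinuousOn φ (closedBall (0 : ℂ) 1)) :
    diskSubmodule φ →ₗ[ℂ] C(sphere (0 : ℂ) 1, ℂ) where
  toFun f := ⟨fun z => f.1 z,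
    ((diskModule_continuousOn hφ f.2).mono sphere_subset_closedBall).domRestrict⟩
  map_add' _ _ := rfl
  map_smul' _ _ := rfl

/-- A functional that is bounded relative to a linear map into a normed space factors through a
continuous functional on that space. -/
theorem LinearMap.exists_strongDual_comp_eq {V E : Type*} [AddCommGroup V] [Module ℂ V]
    [NormedAddCommGroup E] [NormedSpace ℂ E] (T : V →ₗ[ℂ] E) (ℓ : V →ₗ[ℂ] ℂ) {C : ℝ}
    (h : ∀ v, ‖ℓ v‖ ≤ C * ‖T v‖) : ∃ L : E →L[ℂ] ℂ, ∀ v, L (T v) = ℓ v := by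
  have hker : LinearMap.ker T ≤ LinearMap.ker ℓ := by
    intro v hv
    rw [LinearMap.mem_ker] at hv ⊢
    have := h v
    rw [hv, norm_zero, mul_zero] at this
    exact norm_le_zero_iff.1 this
  let m : LinearMap.range T →ₗ[ℂ] ℂ :=
    ((LinearMap.ker T).liftQ ℓ hker).comp T.quotKerEquivRange.symm.toLinearMap
  have hm : ∀ v, m ⟨T v, LinearMap.mem_range_self T v⟩ = ℓ v := by
    intro v
    have : T.quotKerEquivRange.symm ⟨T v, LinearMap.mem_range_self T v⟩
        = (LinearMap.ker T).mkQ v := by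
      rw [LinearEquiv.symm_apply_eq]
      rfl
    simp only [m, LinearMap.comp_apply, LinearEquiv.coe_coe, this, Submodule.mkQ_apply,
      Submodule.liftQ_apply]
  have hmb : ∀ y, ‖m y‖ ≤ C * ‖y‖ := by
    rintro ⟨_, v, rfl⟩
    rw [hm]
    exact h v
  obtain ⟨L, hL, -⟩ := exists_extension_norm_eq (LinearMap.range T) (m.mkContinuous C hmb)
  exact ⟨L, fun v => (hL ⟨T v, LinearMap.mem_range_self T v⟩).trans (hm v)⟩

/-- Evaluation at an interior point where the module is dominated by the circle extends to a
continuous functional on the continuous functions of the circle. -/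
theorem exists_strongDual_eq_eval {φ : ℂ → ℂ} (hφ : ContinuousOn φ (closedBall (0 : ℂ) 1)) {x : ℂ}
    (hx : ∃ C : ℝ, ∀ f ∈ diskModule φ, ‖f x‖ ≤ C * circleSupNorm f) :
    ∃ L : C(sphere (0 : ℂ) 1, ℂ) →L[ℂ] ℂ, ∀ f ∈ diskModule φ, ∀ g : C(sphere (0 : ℂ) 1, ℂ),
      (∀ z, g z = f z) → L g = f x := by
  obtain ⟨C, hC⟩ := hx
  obtain ⟨L, hL⟩ := (diskSubmodule.restrict hφ).exists_strongDual_comp_eq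
    ((LinearMap.proj x).comp (diskSubmodule φ).subtype) (C := |C|) (by
      intro f
      have : Nonempty (sphere (0 : ℂ) 1) := ⟨⟨1, by simp⟩⟩
      have hsup : circleSupNorm f.1 ≤ ‖diskSubmodule.restrict hφ f‖ :=
        ciSup_le fun z => (diskSubmodule.restrict hφ f).norm_coe_le_norm z
      have hpos : 0 ≤ circleSupNorm f.1 := Real.iSup_nonneg fun z => norm_nonneg _
      calc ‖f.1 x‖ ≤ C * circleSupNorm f.1 := hC f.1 f.2
        _ ≤ |C| * circleSupNorm f.1 := by gcongr; exact le_abs_self C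
        _ ≤ |C| * ‖diskSubmodule.restrict hφ f‖ := by gcongr)
  refine ⟨L, fun f hf g hg => ?_⟩
  have hgf : g = diskSubmodule.restrict hφ ⟨f, hf⟩ := ContinuousMap.ext hg
  rw [hgf, hL]
  rfl

/-! ### Cauchy kernels and difference quotients -/

/-- The Cauchy kernel `ζ ↦ (ζ - w)⁻¹` on the unit circle. -/
noncomputable def cauchyKernel (w : ℂ) : C(sphere (0 : ℂ) 1, ℂ) :=
  Ring.inverse ((⟨Subtype.val, continuous_subtype_val⟩ : C(sphere (0 : ℂ) 1, ℂ))
    - algebraMap ℂ _ w)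

theorem isUnit_circle_sub {w : ℂ} (hw : w ∉ sphere (0 : ℂ) 1) :
    IsUnit ((⟨Subtype.val, continuous_subtype_val⟩ : C(sphere (0 : ℂ) 1, ℂ))
      - algebraMap ℂ _ w) := by
  rw [ContinuousMap.isUnit_iff_forall_ne_zero]
  intro z h0
  refine hw ?_
  have : (z : ℂ) = w := sub_eq_zero.1 h0
  exact this ▸ z.2

theorem cauchyKernel_apply {w : ℂ} (hw : w ∉ sphere (0 : ℂ) 1) (z : sphere (0 : ℂ) 1) :
    cauchyKernel w z = ((z : ℂ) - w)⁻¹ := by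
  have h := congrArg (fun f : C(sphere (0 : ℂ) 1, ℂ) => f z)
    (Ring.inverse_mul_cancel _ (isUnit_circle_sub hw))
  exact eq_inv_of_mul_eq_one_left h

/-- Inversion is holomorphic on the units of the Banach algebra C(Γ), and z - w is affine in w. -/
theorem differentiableOn_cauchyKernel : DifferentiableOn ℂ cauchyKernel (ball 0 1) := by
  intro w hw
  have hw' : w ∉ sphere (0 : ℂ) 1 := fun h => (mem_ball.1 hw).ne (mem_sphere.1 h)
  refine DifferentiableAt.differentiableWithinAt ?_
  refine DifferentiableAt.inverse ?_ (isUnit_circle_sub hw')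
  exact (differentiableAt_const _).sub
    (Algebra.linearMap ℂ C(sphere (0 : ℂ) 1, ℂ)).toContinuousLinearMap.differentiableAt

/-- The difference quotients of a function continuous on the circle with a holomorphic extension
across the point `1` form a holomorphic family of continuous functions. -/
theorem exists_differentiableOn_slope_family {φ Φ : ℂ → ℂ}
    (hφ : ContinuousOn φ (sphere (0 : ℂ) 1)) (hΦ : AnalyticAt ℂ Φ 1)
    (heq : ∀ᶠ w in 𝓝 (1 : ℂ), w ∈ sphere (0 : ℂ) 1 → Φ w = φ w) :
    ∃ s > 0, ∃ k : ℂ → C(sphere (0 : ℂ) 1, ℂ), DifferentiableOn ℂ Φ (ball 1 s) ∧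
      DifferentiableOn ℂ k (ball 1 s) ∧ ∀ w ∈ ball (1 : ℂ) s, ∀ z : sphere (0 : ℂ) 1,
        (z : ℂ) ≠ w → k w z = (φ z - Φ w) * ((z : ℂ) - w)⁻¹ := by
  classical
  obtain ⟨K, t, ht, hK⟩ := hΦ.hasStrictFDerivAt.exists_lipschitzOnWith
  obtain ⟨δ, hδ, hδs⟩ := Metric.eventually_nhds_iff_ball.1
    ((heq.and hΦ.eventually_analyticAt).and ht)
  -- Halving the radius keeps w at distance at least s from every z outside the larger ball.
  obtain ⟨s, hs, rfl⟩ : ∃ s > 0, δ = 2 * s := ⟨δ / 2, by positivity, by ring⟩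
  have hmono : ball (1 : ℂ) s ⊆ ball 1 (2 * s) := ball_subset_ball (by linarith)
  have hlip : LipschitzOnWith K Φ (ball 1 (2 * s)) := hK.mono fun w hw => (hδs w hw).2
  have hdΦ : DifferentiableOn ℂ Φ (ball 1 (2 * s)) := fun w hw =>
    (hδs w hw).1.2.differentiableAt.differentiableWithinAt
  -- Ψ equals φ on the circle and is holomorphic near 1, so `dslope` fills in the diagonal z = w.
  let Ψ : ℂ → ℂ := fun w => if w ∈ ball (1 : ℂ) (2 * s) then Φ w else φ w
  have hΨΦ : ∀ w ∈ ball (1 : ℂ) (2 * s), Ψ w = Φ w := fun w hw => if_pos hw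
  have hΨφ : ∀ w ∈ sphere (0 : ℂ) 1, Ψ w = φ w := by
    intro w hw
    by_cases h : w ∈ ball (1 : ℂ) (2 * s)
    · rw [hΨΦ w h, (hδs w h).1.1 hw]
    · exact if_neg h
  have hdΨ : DifferentiableOn ℂ Ψ (ball 1 (2 * s)) := hdΦ.congr hΨΦ
  have hlipΨ : LipschitzOnWith K Ψ (ball 1 (2 * s)) := by
    intro u hu v hv
    rw [hΨΦ u hu, hΨΦ v hv]
    exact hlip hu hv
  have hcΨ : ContinuousOn Ψ (sphere (0 : ℂ) 1) := hφ.congr hΨφ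
  have hkc : ∀ w ∈ ball (1 : ℂ) s, Continuous fun z : sphere (0 : ℂ) 1 => dslope Ψ w z := by
    intro w hw
    have : ContinuousOn (dslope Ψ w) (sphere (0 : ℂ) 1) := by
      intro z hz
      by_cases hzw : z = w
      · subst hzw
        exact (continuousAt_dslope_same.2
          (hdΨ.differentiableAt (isOpen_ball.mem_nhds (hmono hw)))).continuousWithinAt
      · exact (continuousWithinAt_dslope_of_ne hzw).2 (hcΨ z hz)
    exact this.domRestrict
  let k : ℂ → C(sphere (0 : ℂ) 1, ℂ) := fun w =>
    if hw : w ∈ ball (1 : ℂ) s then ⟨_, hkc w hw⟩ else 0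
  have hk : ∀ w ∈ ball (1 : ℂ) s, ∀ z, k w z = dslope Ψ w z := by
    intro w hw z
    simp only [k, dif_pos hw]
    rfl
  -- Symmetry turns continuity in z for fixed w into holomorphy in w for fixed z.
  have hsymm : ∀ u v, dslope Ψ u v = dslope Ψ v u := by
    intro u v
    rcases eq_or_ne u v with rfl | huv
    · rfl
    · rw [dslope_of_ne _ huv.symm, dslope_of_ne _ huv, slope_comm]
  obtain ⟨A, hA⟩ : ∃ A, ∀ z ∈ sphere (0 : ℂ) 1, ‖φ z‖ ≤ A :=
    (isCompact_sphere 0 1).exists_bound_of_continuousOn hφ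
  have h1mem : (1 : ℂ) ∈ ball (1 : ℂ) (2 * s) := mem_ball_self (by positivity)
  have hΨb : ∀ w ∈ ball (1 : ℂ) s, ‖Ψ w‖ ≤ A + K * s := by
    intro w hw
    have h1 := hlipΨ.dist_le_mul w (hmono hw) 1 h1mem
    have h2 : ‖Ψ 1‖ ≤ A := by
      rw [hΨφ 1 (by simp)]
      exact hA 1 (by simp)
    have h3 : (K : ℝ) * dist w 1 ≤ K * s := by
      gcongr
      exact (mem_ball.1 hw).le
    rw [dist_eq_norm] at h1
    have h4 := norm_sub_norm_le (Ψ w) (Ψ 1)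
    linarith
  refine ⟨s, hs, k, hdΦ.mono hmono, ?_, ?_⟩
  · refine ContinuousMap.differentiableOn_ball_of_bounded (B := max K ((A + (A + K * s)) / s))
      ?_ ?_
    · intro z
      have : DifferentiableOn ℂ (dslope Ψ z) (ball 1 s) := by
        by_cases hz : (z : ℂ) ∈ ball (1 : ℂ) (2 * s)
        · exact ((Complex.differentiableOn_dslope (isOpen_ball.mem_nhds hz)).2 hdΨ).mono hmono
        · exact (differentiableOn_dslope_of_notMem fun h => hz (hmono h)).2 (hdΨ.mono hmono)
      exact this.congr fun w hw => (hk w hw z).trans (hsymm _ _)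
    · intro w hw z
      rw [hk w hw]
      by_cases hz : (z : ℂ) ∈ ball (1 : ℂ) (2 * s)
      · refine le_max_of_le_left ?_
        by_cases hzw : (z : ℂ) = w
        · rw [hzw, dslope_same]
          exact norm_deriv_le_of_lipschitzOn (isOpen_ball.mem_nhds (hmono hw)) hlipΨ
        · rw [dslope_of_ne _ hzw, slope_def_field, norm_div, ← dist_eq_norm, ← dist_eq_norm,
            div_le_iff₀ (dist_pos.2 hzw)]
          exact hlipΨ.dist_le_mul z hz w (hmono hw)
      · refine le_max_of_le_right ?_
        have hdist : s ≤ ‖(z : ℂ) - w‖ := by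
          rw [← dist_eq_norm]
          have h1 := dist_triangle (z : ℂ) w 1
          have h2 := mem_ball.1 hw
          rw [mem_ball, not_lt] at hz
          linarith
        have hzw : (z : ℂ) ≠ w := fun h => hz (h ▸ hmono hw)
        rw [dslope_of_ne _ hzw, slope_def_field, norm_div]
        have h1 : ‖Ψ z - Ψ w‖ ≤ A + (A + K * s) := by
          refine (norm_sub_le _ _).trans (add_le_add ?_ (hΨb w hw))
          rw [hΨφ z z.2]
          exact hA z z.2
        exact div_le_div₀ ((norm_nonneg _).trans h1) h1 hs hdist
  · intro w hw z hzw
    rw [hk w hw, dslope_of_ne _ hzw, slope_def_field, hΨφ z z.2, hΨΦ w (hmono hw), div_eq_mul_inv]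

/-! ### Quotient representation and conclusion -/

/-- If evaluation at `x` on the module is represented by a functional on the circle, then near `1`
the extension of `φ` is a quotient of functions holomorphic in the disk, whose values at `x` are
`φ x` and `1`. -/
theorem exists_quotient_representation {φ Φ : ℂ → ℂ} {s : ℝ} {k : ℂ → C(sphere (0 : ℂ) 1, ℂ)}
    (hφ : ContinuousOn φ (closedBall (0 : ℂ) 1)) (hs : 0 < s)
    (hΦ : DifferentiableOn ℂ Φ (ball 1 s)) (hkd : DifferentiableOn ℂ k (ball 1 s))
    (hk : ∀ w ∈ ball (1 : ℂ) s, ∀ z : sphere (0 : ℂ) 1,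
        (z : ℂ) ≠ w → k w z = (φ z - Φ w) * ((z : ℂ) - w)⁻¹)
    {x : ℂ} (hx : x ∈ ball (0 : ℂ) 1) {L : C(sphere (0 : ℂ) 1, ℂ) →L[ℂ] ℂ}
    (hL : ∀ f ∈ diskModule φ, ∀ g : C(sphere (0 : ℂ) 1, ℂ), (∀ z, g z = f z) → L g = f x) :
    ∃ G H : ℂ → ℂ, DifferentiableOn ℂ G (ball 0 1) ∧ DifferentiableOn ℂ H (ball 0 1) ∧
      G x = φ x ∧ H x = 1 ∧ ∀ w ∈ ball (1 : ℂ) s ∩ ball 0 1, Φ w * H w = G w := by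
  have hident : ∀ w ∈ ball (1 : ℂ) s, (x - w) * L (k w) - φ x + Φ w = 0 := by
    have hd : DifferentiableOn ℂ (fun w => (x - w) * L (k w) - φ x + Φ w) (ball 1 s) := by
      have h1 : DifferentiableOn ℂ (fun w => L (k w)) (ball 1 s) :=
        L.differentiable.comp_differentiableOn hkd
      fun_prop
    -- The identity theorem starts from a point outside the closed disk, where the kernel lies in
    -- the disk algebra.
    obtain ⟨p, hp, hp1⟩ : ∃ p ∈ ball (1 : ℂ) s, 1 < ‖p‖ := by
      refine ⟨((1 + s / 2 : ℝ) : ℂ), ?_, ?_⟩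
      · rw [mem_ball, dist_eq_norm]
        have : ((1 + s / 2 : ℝ) : ℂ) - 1 = ((s / 2 : ℝ) : ℂ) := by push_cast; ring
        rw [this, Complex.norm_real, Real.norm_of_nonneg (by positivity)]
        linarith
      · rw [Complex.norm_real, Real.norm_of_nonneg (by positivity)]
        linarith
    refine (hd.analyticOnNhd isOpen_ball).eqOn_zero_of_preconnected_of_eventuallyEq_zero
      (convex_ball _ _).isPreconnected hp ?_
    have hopen : IsOpen {w : ℂ | 1 < ‖w‖} := isOpen_lt continuous_const continuous_norm
    filter_upwards [isOpen_ball.mem_nhds hp, hopen.mem_nhds hp1] with w hw hw1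
    have hne : ∀ z ∈ closedBall (0 : ℂ) 1, z - w ≠ 0 := by
      intro z hz h0
      rw [sub_eq_zero.1 h0, mem_closedBall_zero_iff] at hz
      exact absurd hw1 (not_lt.2 hz)
    have hb : (fun z : ℂ => (z - w)⁻¹) ∈ diskAlgebra :=
      ⟨ContinuousOn.inv₀ (by fun_prop) hne,
        DifferentiableOn.inv (by fun_prop) fun z hz => hne z (ball_subset_closedBall hz)⟩
    have hLk := hL (fun z => -Φ w * (z - w)⁻¹ + (z - w)⁻¹ * φ z)
      ⟨_, diskAlgebra_const_mul (-Φ w) hb, _, hb, fun z _ => rfl⟩ (k w) (by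
        intro z
        rw [hk w hw z (sub_ne_zero.1 (hne z (sphere_subset_closedBall z.2)))]
        ring)
    have hxw := hne x (ball_subset_closedBall hx)
    simp only [hLk, Pi.zero_apply]
    field_simp
    ring
  let φc : C(sphere (0 : ℂ) 1, ℂ) :=
    ⟨fun z => φ z, (hφ.mono sphere_subset_closedBall).domRestrict⟩
  have hK : DifferentiableOn ℂ (fun w => L (cauchyKernel w)) (ball 0 1) :=
    L.differentiable.comp_differentiableOn differentiableOn_cauchyKernel
  have hJ : DifferentiableOn ℂ (fun w => L (φc * cauchyKernel w)) (ball 0 1) :=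
    L.differentiable.comp_differentiableOn (differentiableOn_cauchyKernel.const_mul φc)
  have hxd : DifferentiableOn ℂ (fun w => x - w) (ball 0 1) := by fun_prop
  refine ⟨fun w => φ x - (x - w) * L (φc * cauchyKernel w),
    fun w => 1 - (x - w) * L (cauchyKernel w),
    (hxd.mul hJ).const_sub _, (hxd.mul hK).const_sub _, by simp, by simp, ?_⟩
  rintro w ⟨hw, hw1⟩
  have hw' : w ∉ sphere (0 : ℂ) 1 := fun h => (mem_ball.1 hw1).ne (mem_sphere.1 h)
  have hkw : k w = φc * cauchyKernel w - Φ w • cauchyKernel w := by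
    ext z
    have hzw : (z : ℂ) ≠ w := fun h => hw' (h ▸ z.2)
    rw [hk w hw z hzw, ContinuousMap.sub_apply, ContinuousMap.mul_apply, ContinuousMap.smul_apply,
      cauchyKernel_apply hw', smul_eq_mul, sub_mul]
    rfl
  have h := hident w hw
  rw [hkw, map_sub, map_smul, smul_eq_mul] at h
  linear_combination h

theorem theorem2 (φ : ℂ → ℂ)
    (hcont : ContinuousOn φ (closedBall (0 : ℂ) 1))
    (hanal : RealAnalyticOnUnitCircle φ)
    (hbdd : ∀ x ∈ ball (0 : ℂ) 1, ∃ C : ℝ, ∀ f ∈ diskModule φ, ‖f x‖ ≤ C * circleSupNorm f) :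
    DifferentiableOn ℂ φ (ball (0 : ℂ) 1) ∧
      ∀ f ∈ diskModule φ, DifferentiableOn ℂ f (ball (0 : ℂ) 1) := by
  have hmain : DifferentiableOn ℂ φ (ball (0 : ℂ) 1) := by
    obtain ⟨Φ, hΦa, hΦφ⟩ := hanal.exists_extension_near_one
    obtain ⟨s, hs, k, hΦ, hkd, hk⟩ := exists_differentiableOn_slope_family
      (hcont.mono sphere_subset_closedBall) hΦa hΦφ
    have hrep : ∀ x ∈ ball (0 : ℂ) 1, ∃ G H : ℂ → ℂ, DifferentiableOn ℂ G (ball 0 1) ∧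
        DifferentiableOn ℂ H (ball 0 1) ∧ G x = φ x ∧ H x = 1 ∧
        ∀ w ∈ ball (1 : ℂ) s ∩ ball 0 1, Φ w * H w = G w := by
      intro x hx
      obtain ⟨L, hL⟩ := exists_strongDual_eq_eval hcont (hbdd x hx)
      exact exists_quotient_representation hcont hs hΦ hkd hk hx hL
    obtain ⟨p, hp⟩ : (ball (1 : ℂ) s ∩ ball 0 1).Nonempty := by
      have h1 : (1 : ℂ) ∈ closure (ball (0 : ℂ) 1) := by
        rw [closure_ball _ one_ne_zero]
        simp
      exact mem_closure_iff.1 h1 _ isOpen_ball (mem_ball_self hs)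
    intro x hx
    obtain ⟨G, H, hG, hH, -, hHx, hGH⟩ := hrep x hx
    have hquot : ∀ y ∈ ball (0 : ℂ) 1, φ y * H y = G y := by
      intro y hy
      obtain ⟨G', H', hG', hH', hGy, hHy, hGH'⟩ := hrep y hy
      -- Both G'H and GH' equal ΦHH' near p, so they agree on the disk.
      have hzero := ((hG'.mul hH).sub (hG.mul hH')).analyticOnNhd isOpen_ball
        |>.eqOn_zero_of_preconnected_of_eventuallyEq_zero (convex_ball _ _).isPreconnected hp.2 (by
          filter_upwards [(isOpen_ball.inter isOpen_ball).mem_nhds hp] with w hw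
          simp only [Pi.sub_apply, Pi.mul_apply, Pi.zero_apply, ← hGH w hw, ← hGH' w hw]
          ring) hy
      simp only [Pi.sub_apply, Pi.mul_apply, Pi.zero_apply, hGy, hHy] at hzero
      linear_combination hzero
    have hxn := isOpen_ball.mem_nhds hx
    have hdH := hH.differentiableAt hxn
    have hHne : H x ≠ 0 := by simp [hHx]
    refine ((hG.differentiableAt hxn).div hdH hHne |>.congr_of_eventuallyEq ?_)
      |>.differentiableWithinAt
    filter_upwards [hxn, hdH.continuousAt.eventually_ne hHne] with y hy hy0
    rw [Pi.div_apply, ← hquot y hy, mul_div_cancel_right₀ _ hy0]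
  refine ⟨hmain, ?_⟩
  rintro f ⟨a, ha, b, hb, hf⟩
  exact (ha.2.add (hb.2.mul hmain)).congr fun z hz => hf z (ball_subset_closedBall hz)
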